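/- For $n\ge 1$ let $\mathcal T(n)$ be the set of rooted (non-planar) trees whose vertices are in bijection with $[n]=\{1,\dots,n\}$; edges are oriented towards the root, and the incoming vertices of a vertex $i$ are the vertices $k$ such that $(k,i)$ is an oriented edge. For $T\in\mathcal T(n)$, $S\in\mathcal T(m)$ and $1\le i\le n$ let $T\circ_i S\in\mathcal T(n+m-1)$ be the tree obtained by substituting $S$ for the vertex $i$ of $T$: the outgoing vertex of $i$ (if there is one) becomes the outgoing vertex of the root of $S$; an incoming vertex $k$ of $i$ is grafted on the vertex $m$ of $S$ if $k<i$ and on the vertex $1$ of $S$ if $k>i$; then $i-1$ is added to the labels of $S$, and $m-1$ is added to the labels of $T$ that are greater than $i$. With these compositions, and with the one-vertex tree as unit, the sets $\mathcal T(n)$ form a non-symmetric operad in the category of sets, denoted by $\mathcal T_{\mathrm{Max}}$, and for every field $\mathbf k$ the vector spaces $\mathbf k\mathcal T(n)$ form a non-symmetric operad over $\mathbf k$, its linearization $\mathbf k\mathcal T_{\mathrm{Max}}$. Call a tree with $n\ge 2$ vertices indecomposable if it is not of the form $T\circ_i S$ with $T$ and $S$ both having at least two vertices. **Theorem.** The non-symmetric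 operad $\mathcal T_{\mathrm{Max}}$ is free, both in sets and in vector spaces, on the indecomposable trees. Precisely: 1. The operad $\mathcal T_{\mathrm{Max}}$ is reduced (there is no operation of arity $0$, and the unit is the only one of arity $1$), and for every non-symmetric operad $Q$ in sets, every family of maps $\varphi_n$ from the set of indecomposable trees in $\mathcal T(n)$ to $Q(n)$ extends to a unique morphism of operads $\mathcal T_{\mathrm{Max}}\to Q$. 2. For every field $\mathbf k$, the operad $\mathbf k\mathcal T_{\mathrm{Max}}$ is reduced (it vanishes in arity $0$, and is $\mathbf k$, spanned by the unit, in arity $1$), and for every non-symmetric operad $Q$ in $\mathbf k$-vector spaces, every family of linear maps $\varphi_n$ from the span of the indecomposable trees in $\mathbf k\mathcal T(n)$ to $Q(n)$ extends to a unique morphism of operads $\mathbf k\mathcal T_{\mathrm{Max}}\to Q$. -/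

import Mathlib

/-! ### Non-symmetric operads in sets -/

universe u v w

/-- A non-symmetric operad in the category of sets, given by its partial compositions.
`Op n` is the set of operations of arity `n`. Inputs are numbered from `0`, so `i : Fin n` stands
for the input number `i + 1`, and `comp h i a b` is the partial composition usually written
`a ∘_{i+1} b`. The arity `l = n + m - 1` of the result is recorded by the equation
`h : l + 1 = n + m`, so that no transport between arities is needed. -/
structure NSOperad where
  Op : ℕ → Type u
  one : Op 1
  comp : ∀ {n m l : ℕ}, l + 1 = n + m → Fin n → Op n → Op m → Op l
  /-- `(a ∘_i b) ∘_{i+j-1} c = a ∘_i (b ∘_j c)` (positions counted from `1`). -/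
  comp_assoc : ∀ {n m p q r s : ℕ} (h₁ : q + 1 = n + m) (h₂ : r + 1 = q + p)
    (h₃ : s + 1 = m + p) (h₄ : r + 1 = n + s) (i : Fin n) (j : Fin m)
    (a : Op n) (b : Op m) (c : Op p),
    comp h₂ ⟨i + j, by omega⟩ (comp h₁ i a b) c = comp h₄ i a (comp h₃ j b c)
  /-- `(a ∘_i b) ∘_j c = (a ∘_j c) ∘_{i+p-1} b` for `j < i`, where `p` is the arity of `c`. -/
  comp_comm : ∀ {n m p q r s : ℕ} (h₁ : q + 1 = n + m) (h₂ : r + 1 = q + p)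
    (h₃ : s + 1 = n + p) (h₄ : r + 1 = s + m) (i j : Fin n) (hji : (j : ℕ) < i)
    (a : Op n) (b : Op m) (c : Op p),
    comp h₂ ⟨j, by omega⟩ (comp h₁ i a b) c
      = comp h₄ ⟨i + p - 1, by omega⟩ (comp h₃ j a c) b
  one_comp : ∀ {n : ℕ} (h : n + 1 = 1 + n) (a : Op n), comp h 0 one a = a
  comp_one : ∀ {n : ℕ} (h : n + 1 = n + 1) (i : Fin n) (a : Op n), comp h i a one = a

namespace NSOperad

/-- Morphisms of non-symmetric operads. -/
structure Hom (P : NSOperad.{u}) (Q : NSOperad.{v}) where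
  toFun : ∀ n, P.Op n → Q.Op n
  map_one : toFun 1 P.one = Q.one
  map_comp : ∀ {n m l : ℕ} (h : l + 1 = n + m) (i : Fin n) (a : P.Op n) (b : P.Op m),
    toFun l (P.comp h i a b) = Q.comp h i (toFun n a) (toFun m b)

/-- No operation of arity `0`, and the unit is the only operation of arity `1`. -/
def IsReduced (P : NSOperad.{u}) : Prop :=
  IsEmpty (P.Op 0) ∧ ∀ x : P.Op 1, x = P.one

/-- `x` is the result of a non-trivial composition, that is, of a composition of two operations
both of arity at least `2`. -/
def IsDecomposable (P : NSOperad.{u}) {l : ℕ} (x : P.Op l) : Prop :=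
  ∃ (n m : ℕ) (h : l + 1 = n + m) (i : Fin n) (a : P.Op n) (b : P.Op m),
    2 ≤ n ∧ 2 ≤ m ∧ x = P.comp h i a b

/-- The operations of arity `n ≥ 2` that are not the result of a non-trivial composition. -/
def indecomposables (P : NSOperad.{u}) (n : ℕ) : Set (P.Op n) :=
  {x | 2 ≤ n ∧ ¬ P.IsDecomposable x}

/-- `P` is the free non-symmetric operad on the collection `E` of its operations: every arity
preserving map from `E` to a non-symmetric operad `Q` extends to exactly one morphism of operads
from `P` to `Q`. -/
def IsFreeOn (P : NSOperad.{u}) (E : ∀ n, Set (P.Op n)) : Prop :=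
  ∀ (Q : NSOperad.{v}) (φ : ∀ n, E n → Q.Op n),
    ∃! F : Hom P Q, ∀ (n : ℕ) (x : E n), F.toFun n x = φ n x

end NSOperad

/-! ### Non-symmetric operads in vector spaces -/

/-- A non-symmetric operad in vector spaces over `k`, with the same conventions as for
`NSOperad`; the partial compositions are bilinear. -/
structure LinNSOperad (k : Type u) [Field k] where
  Op : ℕ → Type v
  [addCommGroup : ∀ n, AddCommGroup (Op n)]
  [module : ∀ n, Module k (Op n)]
  one : Op 1
  comp : ∀ {n m l : ℕ}, l + 1 = n + m → Fin n → (Op n →ₗ[k] Op m →ₗ[k] Op l)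
  comp_assoc : ∀ {n m p q r s : ℕ} (h₁ : q + 1 = n + m) (h₂ : r + 1 = q + p)
    (h₃ : s + 1 = m + p) (h₄ : r + 1 = n + s) (i : Fin n) (j : Fin m)
    (a : Op n) (b : Op m) (c : Op p),
    comp h₂ ⟨i + j, by omega⟩ (comp h₁ i a b) c = comp h₄ i a (comp h₃ j b c)
  comp_comm : ∀ {n m p q r s : ℕ} (h₁ : q + 1 = n + m) (h₂ : r + 1 = q + p)
    (h₃ : s + 1 = n + p) (h₄ : r + 1 = s + m) (i j : Fin n) (hji : (j : ℕ) < i)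
    (a : Op n) (b : Op m) (c : Op p),
    comp h₂ ⟨j, by omega⟩ (comp h₁ i a b) c
      = comp h₄ ⟨i + p - 1, by omega⟩ (comp h₃ j a c) b
  one_comp : ∀ {n : ℕ} (h : n + 1 = 1 + n) (a : Op n), comp h 0 one a = a
  comp_one : ∀ {n : ℕ} (h : n + 1 = n + 1) (i : Fin n) (a : Op n), comp h i a one = a

attribute [instance] LinNSOperad.addCommGroup LinNSOperad.module

namespace LinNSOperad

/-- Morphisms of linear non-symmetric operads. -/
structure Hom {k : Type u} [Field k] (P : LinNSOperad.{u, v} k) (Q : LinNSOperad.{u, w} k) where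
  toFun : ∀ n, P.Op n →ₗ[k] Q.Op n
  map_one : toFun 1 P.one = Q.one
  map_comp : ∀ {n m l : ℕ} (h : l + 1 = n + m) (i : Fin n) (a : P.Op n) (b : P.Op m),
    toFun l (P.comp h i a b) = Q.comp h i (toFun n a) (toFun m b)

/-- There is nothing in arity `0`, and arity `1` is the ground field with basis the unit. -/
def IsReduced {k : Type u} [Field k] (P : LinNSOperad.{u, v} k) : Prop :=
  Subsingleton (P.Op 0) ∧ Function.Bijective (fun c : k => c • P.one)

/-- `P` is the free linear non-symmetric operad on the collection `V` of subspaces: every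
arity preserving collection of linear maps from `V` to a linear non-symmetric operad `Q` extends
to exactly one morphism of operads from `P` to `Q`. -/
def IsFreeOn {k : Type u} [Field k] (P : LinNSOperad.{u, v} k)
    (V : ∀ n, Submodule k (P.Op n)) : Prop :=
  ∀ (Q : LinNSOperad.{u, w} k) (φ : ∀ n, V n →ₗ[k] Q.Op n),
    ∃! F : Hom P Q, ∀ (n : ℕ) (x : V n), F.toFun n x = φ n x

end LinNSOperad

/-- The bilinear extension of a partial composition of `P`. -/
noncomputable def NSOperad.linComp (k : Type u) [Field k] (P : NSOperad.{v}) {n m l : ℕ}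
    (h : l + 1 = n + m) (i : Fin n) :
    (P.Op n →₀ k) →ₗ[k] (P.Op m →₀ k) →ₗ[k] (P.Op l →₀ k) :=
  Finsupp.linearCombination k (fun a => Finsupp.lmapDomain k k (P.comp h i a))

theorem NSOperad.linComp_single {k : Type u} [Field k] (P : NSOperad.{v}) {n m l : ℕ}
    (h : l + 1 = n + m) (i : Fin n) (a : P.Op n) (b : P.Op m) (x y : k) :
    P.linComp k h i (Finsupp.single a x) (Finsupp.single b y)
      = Finsupp.single (P.comp h i a b) (x * y) := by
  rw [NSOperad.linComp, Finsupp.linearCombination_single, LinearMap.smul_apply,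
    Finsupp.lmapDomain_apply, Finsupp.mapDomain_single, Finsupp.smul_single, smul_eq_mul]

/-- The linearization of a set operad: `n`-ary operations are the formal `k`-linear combinations
of `n`-ary operations of `P`, and compositions are extended bilinearly. -/
noncomputable def NSOperad.linearize (k : Type u) [Field k] (P : NSOperad.{v}) :
    LinNSOperad k where
  Op n := P.Op n →₀ k
  one := Finsupp.single P.one 1
  comp h i := P.linComp k h i
  comp_assoc h₁ h₂ h₃ h₄ i j a b c := by
    induction a using Finsupp.induction_linear with
    | zero => simp
    | add a a' ha ha' => simp only [map_add, LinearMap.add_apply, ha, ha']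
    | single a x =>
    induction b using Finsupp.induction_linear with
    | zero => simp
    | add b b' hb hb' => simp only [map_add, LinearMap.add_apply, hb, hb']
    | single b y =>
    induction c using Finsupp.induction_linear with
    | zero => simp
    | add c c' hc hc' => simp only [map_add, hc, hc']
    | single c z => simp only [P.linComp_single, P.comp_assoc h₁ h₂ h₃ h₄, mul_assoc]
  comp_comm h₁ h₂ h₃ h₄ i j hji a b c := by
    induction a using Finsupp.induction_linear with
    | zero => simp
    | add a a' ha ha' => simp only [map_add, LinearMap.add_apply, ha, ha']
    | single a x =>
    induction b using Finsupp.induction_linear with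
    | zero => simp
    | add b b' hb hb' => simp only [map_add, LinearMap.add_apply, hb, hb']
    | single b y =>
    induction c using Finsupp.induction_linear with
    | zero => simp
    | add c c' hc hc' => simp only [map_add, LinearMap.add_apply, hc, hc']
    | single c z =>
      simp only [P.linComp_single, P.comp_comm h₁ h₂ h₃ h₄ i j hji, mul_assoc, mul_comm y z]
  one_comp h a := by
    induction a using Finsupp.induction_linear with
    | zero => simp
    | add a a' ha ha' => simp only [map_add, ha, ha']
    | single a x => simp only [P.linComp_single, P.one_comp h, one_mul]
  comp_one h i a := by
    induction a using Finsupp.induction_linear with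
    | zero => simp
    | add a a' ha ha' => simp only [map_add, LinearMap.add_apply, ha, ha']
    | single a x => simp only [P.linComp_single, P.comp_one h, mul_one]

/-! ### Labelled rooted trees -/

/-- An `n`-labelled rooted tree. The vertices are the elements of `Fin n`; the vertex `a`
carries the label `a + 1`. Edges are oriented towards the root: `parent a = some b` says that
`b` is the outgoing vertex of `a`, equivalently that `a` is an incoming vertex of `b`. The root is
a vertex without outgoing vertex, and every vertex is joined to the root by an oriented path. -/
structure LabelledTree (n : ℕ) where
  root : Fin n
  parent : Fin n → Option (Fin n)
  parent_root : parent root = none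
  path_root : ∀ a, Relation.ReflTransGen (fun x y => parent x = some y) a root

namespace LabelledTree

theorem ext_parent {n : ℕ} {T S : LabelledTree n} (h : ∀ a, T.parent a = S.parent a) : T = S := by
  have hp : T.parent = S.parent := funext h
  have hr : T.root = S.root := by
    rcases Relation.ReflTransGen.cases_head (S.path_root T.root) with h' | ⟨c, hc, -⟩
    · exact h'
    · rw [← h, T.parent_root] at hc
      simp at hc
  cases T
  cases S
  simp only at hp hr
  subst hp hr
  rfl

/-- The new name in `T ∘_i S` of a vertex `a ≠ i` of `T`, where `S` has `m` vertices. -/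
def embT {n m l : ℕ} (h : l + 1 = n + m) (hm : 0 < m) (i a : Fin n) : Fin l :=
  ⟨if (a : ℕ) < i then a else a + m - 1, by split_ifs <;> omega⟩

/-- The new name in `T ∘_i S` of a vertex `b` of `S`. -/
def embS {n m l : ℕ} (h : l + 1 = n + m) (i : Fin n) (b : Fin m) : Fin l :=
  ⟨b + i, by omega⟩

/-- The vertex of `T` (different from `i`) or of `S` whose new name in `T ∘_i S` is `x`. -/
def origin {n m l : ℕ} (h : l + 1 = n + m) (i : Fin n) (x : Fin l) : Fin n ⊕ Fin m :=
  if h₁ : (x : ℕ) < i then .inl ⟨x, by omega⟩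
  else if h₂ : (x : ℕ) < i + m then .inr ⟨x - i, by omega⟩
  else .inl ⟨x + 1 - m, by omega⟩

theorem origin_embT {n m l : ℕ} (h : l + 1 = n + m) (hm : 0 < m) (i a : Fin n) (ha : a ≠ i) :
    origin h i (embT h hm i a) = .inl a := by
  have ha' : (a : ℕ) ≠ i := fun e => ha (Fin.ext e)
  unfold origin embT
  by_cases h₁ : (a : ℕ) < i
  · simp [h₁]
  · have h₂ : ¬ ((a : ℕ) + m - 1 < i) := by omega
    have h₃ : ¬ ((a : ℕ) + m - 1 < i + m) := by omega
    simp only [h₁, h₂, h₃, if_false, dite_false]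
    congr 1
    apply Fin.ext
    simp only
    omega

theorem origin_embS {n m l : ℕ} (h : l + 1 = n + m) (i : Fin n) (b : Fin m) :
    origin h i (embS h i b) = .inr b := by
  unfold origin embS
  have h₁ : ¬ ((b : ℕ) + i < i) := by omega
  have h₂ : (b : ℕ) + i < i + m := by omega
  simp [h₁, h₂]

theorem eq_embT_or_eq_embS {n m l : ℕ} (h : l + 1 = n + m) (hm : 0 < m) (i : Fin n) (x : Fin l) :
    (∃ a, a ≠ i ∧ x = embT h hm i a) ∨ ∃ b, x = embS h i b := by
  by_cases h₁ : (x : ℕ) < i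
  · refine .inl ⟨⟨x, by omega⟩, ?_, ?_⟩
    · intro e
      have := congrArg Fin.val e
      simp only at this
      omega
    · apply Fin.ext
      simp [embT, h₁]
  · by_cases h₂ : (x : ℕ) < i + m
    · refine .inr ⟨⟨x - i, by omega⟩, ?_⟩
      apply Fin.ext
      simp only [embS]
      omega
    · refine .inl ⟨⟨x + 1 - m, by omega⟩, ?_, ?_⟩
      · intro e
        have := congrArg Fin.val e
        simp only at this
        omega
      · apply Fin.ext
        simp only [embT]
        split_ifs <;> omega

/-- The outgoing vertices in `T ∘_i^f S`. A vertex `a ≠ i` of `T` keeps its outgoing vertex, except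
that it is grafted on the vertex `f a` of `S` if its outgoing vertex was `i`. A vertex of `S`
other than the root of `S` keeps its outgoing vertex, and the outgoing vertex of the root of `S`
becomes the one that `i` had in `T`, if there is one. -/
def graftParent {n m l : ℕ} (h : l + 1 = n + m) (hm : 0 < m) (i : Fin n)
    (T : LabelledTree n) (S : LabelledTree m) (f : Fin n → Fin m) (x : Fin l) : Option (Fin l) :=
  match origin h i x with
  | .inl a => (T.parent a).map fun b => if b = i then embS h i (f a) else embT h hm i b
  | .inr a =>
    match S.parent a with
    | some b => some (embS h i b)
    | none => (T.parent i).map (embT h hm i)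

section

variable {n m l : ℕ} (h : l + 1 = n + m) (hm : 0 < m) (i : Fin n)
  (T : LabelledTree n) (S : LabelledTree m) (f : Fin n → Fin m)

theorem graftParent_embT (a : Fin n) (ha : a ≠ i) :
    graftParent h hm i T S f (embT h hm i a)
      = (T.parent a).map fun b => if b = i then embS h i (f a) else embT h hm i b := by
  rw [graftParent, origin_embT h hm i a ha]

theorem graftParent_embS (a : Fin m) :
    graftParent h hm i T S f (embS h i a)
      = match S.parent a with
        | some b => some (embS h i b)
        | none => (T.parent i).map (embT h hm i) := by
  rw [graftParent, origin_embS h i a]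

theorem parent_ne_self (a : Fin n) : T.parent a ≠ some a := by
  intro e
  have key : ∀ x, Relation.ReflTransGen (fun x y => T.parent x = some y) a x → x = a := by
    intro x hx
    induction hx with
    | refl => rfl
    | tail _ hs ih =>
      subst ih
      rw [e] at hs
      exact (Option.some.inj hs).symm
  have hr := key _ (T.path_root a)
  rw [← hr, T.parent_root] at e
  simp at e

theorem graft_path_S (a : Fin m) :
    Relation.ReflTransGen (fun x y => graftParent h hm i T S f x = some y)
      (embS h i a) (embS h i S.root) := by
  refine Relation.ReflTransGen.lift (p := fun x y => graftParent h hm i T S f x = some y)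
    (embS h i) ?_ _ _ (S.path_root a)
  intro x y hxy
  change graftParent h hm i T S f (embS h i x) = some (embS h i y)
  rw [graftParent_embS, hxy]

theorem graft_path_T (a : Fin n) :
    Relation.ReflTransGen (fun x y => graftParent h hm i T S f x = some y)
      (if a = i then embS h i S.root else embT h hm i a)
      (if T.root = i then embS h i S.root else embT h hm i T.root) := by
  induction T.path_root a using Relation.ReflTransGen.head_induction_on with
  | refl => exact .refl
  | @head a b hab _ ih =>
    by_cases ha : a = i
    · subst ha
      have hb : b ≠ a := fun e => parent_ne_self T a (e ▸ hab)
      rw [if_neg hb] at ih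
      rw [if_pos rfl]
      refine .head ?_ ih
      rw [graftParent_embS, S.parent_root]
      simp [hab]
    · rw [if_neg ha]
      by_cases hb : b = i
      · rw [if_pos hb] at ih
        refine .head (b := embS h i (f a)) ?_ ((graft_path_S h hm i T S f (f a)).trans ih)
        rw [graftParent_embT h hm i T S f a ha, hab]
        simp [hb]
      · rw [if_neg hb] at ih
        refine .head ?_ ih
        rw [graftParent_embT h hm i T S f a ha, hab]
        simp [hb]

end

/-- The tree `T ∘_i^f S` obtained by substituting the tree `S` for the vertex `i` of `T` and
grafting every incoming vertex `a` of `i` on the vertex `f a` of `S`. Only the values of `f` at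
the incoming vertices of `i` matter. -/
def graft {n m l : ℕ} (h : l + 1 = n + m) (i : Fin n)
    (T : LabelledTree n) (S : LabelledTree m) (f : Fin n → Fin m) : LabelledTree l where
  root := if T.root = i then embS h i S.root else embT h S.root.pos i T.root
  parent := graftParent h S.root.pos i T S f
  parent_root := by
    by_cases hr : T.root = i
    · rw [if_pos hr, graftParent_embS, S.parent_root, ← hr, T.parent_root]
      rfl
    · rw [if_neg hr, graftParent_embT _ _ _ _ _ _ _ hr, T.parent_root]
      rfl
  path_root x := by
    rcases eq_embT_or_eq_embS h S.root.pos i x with ⟨a, ha, rfl⟩ | ⟨b, rfl⟩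
    · have := graft_path_T h S.root.pos i T S f a
      rwa [if_neg ha] at this
    · have := graft_path_T h S.root.pos i T S f i
      rw [if_pos rfl] at this
      exact (graft_path_S h S.root.pos i T S f b).trans this

/-- The map `f_Max`: vertices with a label smaller than that of `i` are sent to the vertex of `S`
with the largest label, the other ones to the vertex of `S` with the smallest label. -/
def fMax {n m : ℕ} (hm : 0 < m) (i a : Fin n) : Fin m :=
  if a < i then ⟨m - 1, by omega⟩ else ⟨0, hm⟩

/-- The composition `T ∘_i S` of `T_Max`. -/
def compMax {n m l : ℕ} (h : l + 1 = n + m) (i : Fin n)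
    (T : LabelledTree n) (S : LabelledTree m) : LabelledTree l :=
  graft h i T S (fMax S.root.pos i)

/-- The tree with one vertex. -/
def single : LabelledTree 1 where
  root := 0
  parent _ := none
  parent_root := rfl
  path_root a := by
    rw [Subsingleton.elim a 0]

theorem compMax_parent_T {n m l : ℕ} (h : l + 1 = n + m) (hm : 0 < m) (i : Fin n)
    (T : LabelledTree n) (S : LabelledTree m) (a : Fin n) (ha : a ≠ i) :
    (compMax h i T S).parent (embT h hm i a) = (T.parent a).map fun b =>
      if b = i then embS h i (fMax hm i a) else embT h hm i b :=
  graftParent_embT h _ i T S _ a ha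

theorem compMax_parent_S {n m l : ℕ} (h : l + 1 = n + m) (hm : 0 < m) (i : Fin n)
    (T : LabelledTree n) (S : LabelledTree m) (a : Fin m) :
    (compMax h i T S).parent (embS h i a) = match S.parent a with
      | some b => some (embS h i b)
      | none => (T.parent i).map (embT h hm i) :=
  graftParent_embS h _ i T S _ a

theorem compMax_assoc {n m p q r s : ℕ} (h₁ : q + 1 = n + m) (h₂ : r + 1 = q + p)
    (h₃ : s + 1 = m + p) (h₄ : r + 1 = n + s) (i : Fin n) (j : Fin m)
    (T : LabelledTree n) (S : LabelledTree m) (U : LabelledTree p) :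
    compMax h₂ ⟨i + j, by omega⟩ (compMax h₁ i T S) U
      = compMax h₄ i T (compMax h₃ j S U) := by
  have hm : 0 < m := S.root.pos
  have hp : 0 < p := U.root.pos
  have hs : 0 < s := by omega
  have hij : (i + j : ℕ) < q := by omega
  have eij : (⟨i + j, hij⟩ : Fin q) = embS h₁ i j := Fin.ext (Nat.add_comm _ _)
  apply ext_parent
  intro x
  rcases eq_embT_or_eq_embS h₂ hp ⟨i + j, hij⟩ x with ⟨y, hy, rfl⟩ | ⟨c, rfl⟩
  · rw [compMax_parent_T h₂ hp _ _ _ y hy]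
    rcases eq_embT_or_eq_embS h₁ hm i y with ⟨a, ha, rfl⟩ | ⟨b, rfl⟩
    · have ha' : (a : ℕ) ≠ i := fun e => ha (Fin.ext e)
      have e : embT h₂ hp ⟨i + j, hij⟩ (embT h₁ hm i a) = embT h₄ hs i a := by
        apply Fin.ext
        simp only [embT]
        split_ifs <;> omega
      rw [e, compMax_parent_T h₁ hm _ _ _ a ha, compMax_parent_T h₄ hs _ _ _ a ha]
      rcases T.parent a with _ | w
      · rfl
      · simp only [Option.map_some, Option.some.injEq]
        apply Fin.ext
        simp only [embT, embS, fMax, Fin.ext_iff, Fin.lt_def]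
        grind
    · have hb' : (b : ℕ) ≠ j := fun e => hy (Fin.ext (by simp only [embS]; omega))
      have hb : b ≠ j := fun e => hb' (congrArg Fin.val e)
      have e : embT h₂ hp ⟨i + j, hij⟩ (embS h₁ i b) = embS h₄ i (embT h₃ hp j b) := by
        apply Fin.ext
        simp only [embT, embS]
        grind
      rw [e, compMax_parent_S h₁ hm, compMax_parent_S h₄ hs, compMax_parent_T h₃ hp _ _ _ b hb]
      rcases S.parent b with _ | w
      · rcases hT : T.parent i with _ | v
        · rfl
        · have hv : v ≠ i := fun e => parent_ne_self T i (e ▸ hT)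
          have hv' : (v : ℕ) ≠ i := fun e => hv (Fin.ext e)
          simp only [Option.map_some, Option.map_none, Option.some.injEq]
          apply Fin.ext
          simp only [embT, embS, fMax, Fin.ext_iff, Fin.lt_def]
          grind
      · simp only [Option.map_some, Option.some.injEq]
        apply Fin.ext
        simp only [embT, embS, fMax, Fin.ext_iff, Fin.lt_def]
        grind
  · have e : embS h₂ ⟨i + j, hij⟩ c = embS h₄ i (embS h₃ j c) := by
      apply Fin.ext
      simp only [embS]
      omega
    rw [e, compMax_parent_S h₄ hs, compMax_parent_S h₃ hp, ← e, compMax_parent_S h₂ hp, eij,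
      compMax_parent_S h₁ hm]
    rcases U.parent c with _ | w
    · rcases hS : S.parent j with _ | v
      · rcases hT : T.parent i with _ | v
        · rfl
        · have hv' : (v : ℕ) ≠ i := fun e => parent_ne_self T i (Fin.ext e ▸ hT)
          simp only [Option.map_some, Option.map_none, Option.some.injEq]
          apply Fin.ext
          simp only [embT, embS]
          grind
      · have hv' : (v : ℕ) ≠ j := fun e => parent_ne_self S j (Fin.ext e ▸ hS)
        simp only [Option.map_some, Option.some.injEq]
        apply Fin.ext
        simp only [embT, embS]
        grind
    · simp only [Option.some.injEq]
      apply Fin.ext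
      simp only [embS]
      omega

theorem compMax_comm {n m p q r s : ℕ} (h₁ : q + 1 = n + m) (h₂ : r + 1 = q + p)
    (h₃ : s + 1 = n + p) (h₄ : r + 1 = s + m) (i j : Fin n) (hji : (j : ℕ) < i)
    (T : LabelledTree n) (S : LabelledTree m) (U : LabelledTree p) :
    compMax h₂ ⟨j, by omega⟩ (compMax h₁ i T S) U
      = compMax h₄ ⟨i + p - 1, by omega⟩ (compMax h₃ j T U) S := by
  have hm : 0 < m := S.root.pos
  have hp : 0 < p := U.root.pos
  have hjq : (j : ℕ) < q := by omega
  have his : (i + p - 1 : ℕ) < s := by omega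
  have ej : (⟨j, hjq⟩ : Fin q) = embT h₁ hm i j := Fin.ext (by simp [embT, hji])
  have ei : (⟨i + p - 1, his⟩ : Fin s) = embT h₃ hp j i :=
    Fin.ext (by simp only [embT]; split_ifs <;> omega)
  have hij' : i ≠ j := fun e => by simp [e] at hji
  apply ext_parent
  intro x
  rcases eq_embT_or_eq_embS h₂ hp ⟨j, hjq⟩ x with ⟨y, hy, rfl⟩ | ⟨c, rfl⟩
  · rw [compMax_parent_T h₂ hp _ _ _ y hy]
    rcases eq_embT_or_eq_embS h₁ hm i y with ⟨a, ha, rfl⟩ | ⟨b, rfl⟩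
    · have ha' : (a : ℕ) ≠ i := fun e => ha (Fin.ext e)
      have haj' : (a : ℕ) ≠ j := fun e => hy (by rw [ej, Fin.ext e])
      have haj : a ≠ j := fun e => haj' (congrArg Fin.val e)
      have e : embT h₂ hp ⟨j, hjq⟩ (embT h₁ hm i a)
          = embT h₄ hm ⟨i + p - 1, his⟩ (embT h₃ hp j a) := by
        apply Fin.ext
        simp only [embT]
        split_ifs <;> omega
      have hne : embT h₃ hp j a ≠ ⟨i + p - 1, his⟩ := by
        intro e
        have := congrArg Fin.val e
        simp only [embT] at this
        split_ifs at this <;> omega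
      rw [e, compMax_parent_T h₁ hm _ _ _ a ha, compMax_parent_T h₄ hm _ _ _ _ hne,
        compMax_parent_T h₃ hp _ _ _ a haj]
      rcases T.parent a with _ | w
      · rfl
      · simp only [Option.map_some, Option.some.injEq]
        apply Fin.ext
        simp only [embT, embS, fMax, Fin.ext_iff, Fin.lt_def]
        grind
    · have e : embT h₂ hp ⟨j, hjq⟩ (embS h₁ i b) = embS h₄ ⟨i + p - 1, his⟩ b := by
        apply Fin.ext
        simp only [embT, embS]
        grind
      rw [e, compMax_parent_S h₁ hm, compMax_parent_S h₄ hm, ei,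
        compMax_parent_T h₃ hp _ _ _ i hij']
      rcases S.parent b with _ | w
      · rcases hT : T.parent i with _ | v
        · rfl
        · have hv' : (v : ℕ) ≠ i := fun e => parent_ne_self T i (Fin.ext e ▸ hT)
          simp only [Option.map_some, Option.some.injEq]
          apply Fin.ext
          simp only [embT, embS, fMax, Fin.ext_iff, Fin.lt_def]
          grind
      · simp only [Option.map_some, Option.some.injEq]
        apply Fin.ext
        simp only [embT, embS, fMax, Fin.ext_iff, Fin.lt_def]
        grind
  · have e : embS h₂ ⟨j, hjq⟩ c = embT h₄ hm ⟨i + p - 1, his⟩ (embS h₃ j c) := by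
      apply Fin.ext
      simp only [embT, embS]
      grind
    have hne : embS h₃ j c ≠ ⟨i + p - 1, his⟩ := by
      intro e
      have := congrArg Fin.val e
      simp only [embS] at this
      omega
    rw [compMax_parent_S h₂ hp, e, compMax_parent_T h₄ hm _ _ _ _ hne, compMax_parent_S h₃ hp, ej,
      compMax_parent_T h₁ hm _ _ _ j (Ne.symm hij')]
    rcases U.parent c with _ | w
    · rcases hT : T.parent j with _ | v
      · rfl
      · have hv' : (v : ℕ) ≠ j := fun e => parent_ne_self T j (Fin.ext e ▸ hT)
        simp only [Option.map_some, Option.some.injEq]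
        apply Fin.ext
        simp only [embT, embS, fMax, Fin.ext_iff, Fin.lt_def]
        grind
    · simp only [Option.map_some, Option.some.injEq]
      apply Fin.ext
      simp only [embT, embS, fMax, Fin.ext_iff, Fin.lt_def]
      grind

theorem single_compMax {n : ℕ} (h : n + 1 = 1 + n) (S : LabelledTree n) :
    compMax h 0 single S = S := by
  apply ext_parent
  intro x
  have e : embS h 0 x = x := Fin.ext (by simp [embS])
  have key := compMax_parent_S h x.pos 0 single S x
  rw [e] at key
  rw [key]
  rcases S.parent x with _ | w
  · rfl
  · exact congrArg some (Fin.ext (by simp [embS]))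

theorem compMax_single {n : ℕ} (h : n + 1 = n + 1) (i : Fin n) (T : LabelledTree n) :
    compMax h i T single = T := by
  have e : ∀ a, embT h Nat.one_pos i a = a := fun a => Fin.ext (by simp [embT])
  have e' : ∀ b, embS h i b = i := fun b => Fin.ext (by simp [embS])
  apply ext_parent
  intro x
  by_cases hx : x = i
  · subst hx
    have key := compMax_parent_S h Nat.one_pos x T single 0
    rw [e'] at key
    rw [key]
    change (T.parent x).map _ = _
    rcases T.parent x with _ | w
    · rfl
    · exact congrArg some (e w)
  · have key := compMax_parent_T h Nat.one_pos i T single x hx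
    rw [e] at key
    rw [key]
    rcases T.parent x with _ | w
    · rfl
    · simp only [Option.map_some, Option.some.injEq, e, e']
      split_ifs with hw
      · exact hw.symm
      · rfl

end LabelledTree

/-- The non-symmetric set operad `T_Max` of labelled rooted trees. -/
def TMax : NSOperad.{0} where
  Op := LabelledTree
  one := LabelledTree.single
  comp := LabelledTree.compMax
  comp_assoc := LabelledTree.compMax_assoc
  comp_comm := LabelledTree.compMax_comm
  one_comp := LabelledTree.single_compMax
  comp_one := LabelledTree.compMax_single

/-!
A tree `T` is of the form `A ∘_i B` exactly when the interval of labels that `B` occupies is a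
*block*: it spans a subtree, the edges entering it from smaller labels end at its largest vertex
and those entering it from larger labels end at its smallest vertex. The block determines `A` and
`B`, by contraction and restriction of `T`.

Two blocks `I` and `J`, with `I` to the left, cannot overlap properly. Starting in `I \ J` and
following outgoing edges, one cannot step into `I ∩ J`, since such an edge would have to end at the
largest vertex of `J`, which is not in `I`; hence the root of `I` lies in `I \ J`. Symmetrically the
root of `J` lies in `J \ I`. Then outgoing edges never leave `I ∩ J`, which is absurd.

So two blocks are nested or disjoint, and two decompositions of a tree are always the two sides of
`comp_assoc` or of `comp_comm`. Extending a map from the indecomposable trees by recursion on the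
arity is therefore independent of the decompositions used, and yields a morphism. The linear case
follows because linearization is left adjoint to the forgetful functor to set operads.
-/

/-! ### Decompositions and freeness -/

namespace NSOperad

/-- A presentation of `x` as a composition of two operations of arity at least `2`: the data whose
existence `IsDecomposable` asserts. -/
structure Decomposition (P : NSOperad.{u}) {l : ℕ} (x : P.Op l) where
  n : ℕ
  m : ℕ
  h : l + 1 = n + m
  i : Fin n
  a : P.Op n
  b : P.Op m
  two_le_n : 2 ≤ n
  two_le_m : 2 ≤ m
  eq_comp : x = P.comp h i a b

section Decomposition

variable {P : NSOperad.{u}} {Q : NSOperad.{v}} {l : ℕ} {x : P.Op l}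

theorem IsDecomposable.nonempty_decomposition (hx : P.IsDecomposable x) :
    Nonempty (P.Decomposition x) := by
  obtain ⟨n, m, h, i, a, b, hn, hm, hx⟩ := hx
  exact ⟨⟨n, m, h, i, a, b, hn, hm, hx⟩⟩

/-- An arbitrarily chosen decomposition of a decomposable operation. -/
noncomputable def IsDecomposable.decomposition (hx : P.IsDecomposable x) : P.Decomposition x :=
  Classical.choice hx.nonempty_decomposition

namespace Decomposition

theorem isDecomposable (d : P.Decomposition x) : P.IsDecomposable x :=
  ⟨d.n, d.m, d.h, d.i, d.a, d.b, d.two_le_n, d.two_le_m, d.eq_comp⟩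

theorem two_le (d : P.Decomposition x) : 2 ≤ l := by
  linarith [d.h, d.two_le_n, d.two_le_m]

theorem n_lt (d : P.Decomposition x) : d.n < l := by
  linarith [d.h, d.two_le_m]

theorem m_lt (d : P.Decomposition x) : d.m < l := by
  linarith [d.h, d.two_le_n]

/-- `d'` refines the inner factor of `d`: there is an operation `c` such that
`d.b = c ∘ d'.b` and `d'.a = d.a ∘ c`. The two decompositions are then the two sides of
`comp_assoc`. -/
def Nested (d d' : P.Decomposition x) : Prop :=
  ∃ (s : ℕ) (h₃ : d.m + 1 = s + d'.m) (h₄ : d'.n + 1 = d.n + s) (j : Fin s) (c : P.Op s),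
    (d'.i : ℕ) = d.i + j ∧ d.b = P.comp h₃ j c d'.b ∧ d'.a = P.comp h₄ d.i d.a c

/-- The inner factors of `d'` and of `d` are inserted in two inputs `j' < j` of a common
operation `c`. The two decompositions are then the two sides of `comp_comm`. -/
def Parallel (d d' : P.Decomposition x) : Prop :=
  ∃ (s : ℕ) (h₃ : d.n + 1 = s + d'.m) (h₄ : d'.n + 1 = s + d.m) (j j' : Fin s) (c : P.Op s),
    (j' : ℕ) < j ∧ (d'.i : ℕ) = j' ∧ (d.i : ℕ) = j + d'.m - 1 ∧
      d.a = P.comp h₃ j' c d'.b ∧ d'.a = P.comp h₄ j c d.b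

/-- The composition in `Q` of the images of the two factors of a decomposition. -/
def value (F : ∀ n, P.Op n → Q.Op n) (d : P.Decomposition x) : Q.Op l :=
  Q.comp d.h d.i (F _ d.a) (F _ d.b)

end Decomposition

/-- The family of maps `F` commutes with the partial compositions whose result has arity less
than `l`: the induction hypothesis when `F` is shown to be a morphism. -/
def CommutesBelow (F : ∀ n, P.Op n → Q.Op n) (l : ℕ) : Prop :=
  ∀ {n m p : ℕ} (h : p + 1 = n + m) (i : Fin n) (a : P.Op n) (b : P.Op m), p < l →
    F p (P.comp h i a b) = Q.comp h i (F n a) (F m b)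

theorem Decomposition.Nested.value_eq {F : ∀ n, P.Op n → Q.Op n} (hF : CommutesBelow F l)
    {d d' : P.Decomposition x} (hd : d.Nested d') : d.value F = d'.value F := by
  obtain ⟨s, h₃, h₄, j, c, hi, hb, ha⟩ := hd
  have hi' : d'.i = ⟨d.i + j, by omega⟩ := Fin.ext hi
  rw [value, value, hb, ha, hF _ _ _ _ d.m_lt, hF _ _ _ _ d'.n_lt, hi',
    Q.comp_assoc h₄ d'.h h₃ d.h]

theorem Decomposition.Parallel.value_eq {F : ∀ n, P.Op n → Q.Op n} (hF : CommutesBelow F l)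
    {d d' : P.Decomposition x} (hd : d.Parallel d') : d.value F = d'.value F := by
  obtain ⟨s, h₃, h₄, j, j', c, hj, hi', hi, ha, ha'⟩ := hd
  have hi₁ : d'.i = ⟨j', by omega⟩ := Fin.ext hi'
  have hi₂ : d.i = ⟨j + d'.m - 1, by omega⟩ := Fin.ext hi
  rw [value, value, ha, ha', hF _ _ _ _ d.n_lt, hF _ _ _ _ d'.n_lt, hi₁, hi₂,
    Q.comp_comm h₄ d'.h h₃ d.h j j' hj]

end Decomposition

/-- Any two decompositions of an operation are related by one of the two axioms of operads. -/
def HasCompatibleDecompositions (P : NSOperad.{u}) : Prop :=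
  ∀ {l : ℕ} {x : P.Op l} (d d' : P.Decomposition x),
    d.Nested d' ∨ d'.Nested d ∨ d.Parallel d' ∨ d'.Parallel d

attribute [ext] Hom

section Extension

variable {P : NSOperad.{u}} {Q : NSOperad.{v}}

theorem HasCompatibleDecompositions.value_eq (hP : P.HasCompatibleDecompositions) {l : ℕ}
    {x : P.Op l} {F : ∀ n, P.Op n → Q.Op n} (hF : CommutesBelow F l) (d d' : P.Decomposition x) :
    d.value F = d'.value F := by
  rcases hP d d' with hd | hd | hd | hd
  · exact hd.value_eq hF
  · exact (hd.value_eq hF).symm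
  · exact hd.value_eq hF
  · exact (hd.value_eq hF).symm

open Classical in
/-- The extension to `P` of a family of maps defined on the indecomposable operations, by
recursion on the arity along the chosen decompositions. -/
noncomputable def extend (hP : P.IsReduced) (φ : ∀ n, P.indecomposables n → Q.Op n) :
    ∀ n, P.Op n → Q.Op n
  | 0, x => (hP.1.false x).elim
  | 1, _ => Q.one
  | n + 2, x =>
    if hx : P.IsDecomposable x then
      Q.comp hx.decomposition.h hx.decomposition.i
        (extend hP φ hx.decomposition.n hx.decomposition.a)
        (extend hP φ hx.decomposition.m hx.decomposition.b)
    else φ (n + 2) ⟨x, Nat.le_add_left 2 n, hx⟩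
termination_by n => n
decreasing_by exacts [hx.decomposition.n_lt, hx.decomposition.m_lt]

variable (hP : P.IsReduced) (φ : ∀ n, P.indecomposables n → Q.Op n)

theorem extend_one (x : P.Op 1) : extend hP φ 1 x = Q.one := by
  rw [extend]

theorem extend_indecomposable (n : ℕ) (x : P.indecomposables n) :
    extend hP φ n x = φ n x := by
  obtain ⟨x, hn, hx⟩ := x
  obtain ⟨n, rfl⟩ := Nat.exists_eq_add_of_le' hn
  rw [extend, dif_neg hx]

theorem extend_decomposable {l : ℕ} {x : P.Op l} (hx : P.IsDecomposable x) :
    extend hP φ l x = hx.decomposition.value (extend hP φ) := by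
  obtain ⟨n, rfl⟩ := Nat.exists_eq_add_of_le' hx.decomposition.two_le
  rw [extend, dif_pos hx, Decomposition.value]

theorem extend_comp (hP' : P.HasCompatibleDecompositions) {n m l : ℕ} (h : l + 1 = n + m)
    (i : Fin n) (a : P.Op n) (b : P.Op m) :
    extend hP φ l (P.comp h i a b) = Q.comp h i (extend hP φ n a) (extend hP φ m b) := by
  induction l using Nat.strong_induction_on generalizing n m with
  | _ l ih =>
  have commutesBelow : CommutesBelow (extend hP φ) l := fun h i a b hp => ih _ hp h i a b
  have n_ne_zero : n ≠ 0 := by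
    rintro rfl
    exact hP.1.false a
  have m_ne_zero : m ≠ 0 := by
    rintro rfl
    exact hP.1.false b
  obtain rfl | hn : n = 1 ∨ 2 ≤ n := by omega
  · obtain rfl : l = m := by omega
    rw [hP.2 a, Subsingleton.elim i 0, P.one_comp, extend_one, Q.one_comp]
  obtain rfl | hm : m = 1 ∨ 2 ≤ m := by omega
  · obtain rfl : l = n := by omega
    rw [hP.2 b, P.comp_one, extend_one, Q.comp_one]
  let d : P.Decomposition (P.comp h i a b) := ⟨n, m, h, i, a, b, hn, hm, rfl⟩
  calc extend hP φ l (P.comp h i a b)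
      = d.isDecomposable.decomposition.value (extend hP φ) := extend_decomposable hP φ _
    _ = d.value (extend hP φ) := hP'.value_eq commutesBelow _ _

theorem Hom.ext_indecomposables (hP : P.IsReduced) {F G : Hom P Q}
    (h : ∀ (n : ℕ) (x : P.indecomposables n), F.toFun n x = G.toFun n x) : F = G := by
  ext n x
  induction n using Nat.strong_induction_on with
  | _ l ih =>
  by_cases hx : P.IsDecomposable x
  · obtain ⟨d⟩ := hx.nonempty_decomposition
    rw [d.eq_comp, F.map_comp, G.map_comp, ih _ d.n_lt, ih _ d.m_lt]
  · match l, x, hx with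
    | 0, x, _ => exact (hP.1.false x).elim
    | 1, x, _ => rw [hP.2 x, F.map_one, G.map_one]
    | l + 2, x, hx => exact h _ ⟨x, Nat.le_add_left 2 l, hx⟩

theorem isFreeOn_indecomposables (hP : P.IsReduced) (hP' : P.HasCompatibleDecompositions) :
    IsFreeOn.{u, v} P P.indecomposables := fun _ φ =>
  ⟨⟨extend hP φ, extend_one hP φ P.one, extend_comp hP φ hP'⟩, extend_indecomposable hP φ,
    fun _ hG => Hom.ext_indecomposables hP fun n x =>
      (hG n x).trans (extend_indecomposable hP φ n x).symm⟩

end Extension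

theorem IsReduced.linearize {P : NSOperad.{v}} (hP : P.IsReduced) (k : Type u) [Field k] :
    (P.linearize k).IsReduced := by
  have := hP.1
  have : Subsingleton (P.Op 1) := ⟨fun x y => (hP.2 x).trans (hP.2 y).symm⟩
  have smul_one : (fun c : k => c • (Finsupp.single P.one 1 : P.Op 1 →₀ k)) =
      (Finsupp.uniqueLinearEquiv k k P.one).symm := by
    funext c
    rw [Finsupp.smul_single_one, LinearEquiv.eq_symm_apply]
    simp
  refine ⟨inferInstanceAs (Subsingleton (P.Op 0 →₀ k)), ?_⟩
  change Function.Bijective fun c : k => c • (Finsupp.single P.one 1 : P.Op 1 →₀ k)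
  rw [smul_one]
  exact LinearEquiv.bijective _

end NSOperad

/-! ### Freeness of the linearization -/

namespace LinNSOperad

attribute [ext] Hom

variable {k : Type u} [Field k]

/-- The set operad underlying a linear operad. -/
def toNSOperad (Q : LinNSOperad.{u, w} k) : NSOperad.{w} where
  Op := Q.Op
  one := Q.one
  comp h i a b := Q.comp h i a b
  comp_assoc := Q.comp_assoc
  comp_comm := Q.comp_comm
  one_comp := Q.one_comp
  comp_one := Q.comp_one

variable {P : NSOperad.{v}} {Q : LinNSOperad.{u, w} k}

theorem linearCombination_linComp (f : ∀ n, P.Op n → Q.Op n)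
    (hf : ∀ {n m l : ℕ} (h : l + 1 = n + m) (i : Fin n) (a : P.Op n) (b : P.Op m),
      f l (P.comp h i a b) = Q.comp h i (f n a) (f m b))
    {n m l : ℕ} (h : l + 1 = n + m) (i : Fin n) (a : P.Op n →₀ k) (b : P.Op m →₀ k) :
    Finsupp.linearCombination k (f l) (P.linComp k h i a b) =
      Q.comp h i (Finsupp.linearCombination k (f n) a) (Finsupp.linearCombination k (f m) b) := by
  induction a using Finsupp.induction_linear with
  | zero => simp
  | add a a' ha ha' => simp only [map_add, LinearMap.add_apply, ha, ha']
  | single a x =>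
  induction b using Finsupp.induction_linear with
  | zero => simp
  | add b b' hb hb' => simp only [map_add, hb, hb']
  | single b y =>
    simp only [P.linComp_single, Finsupp.linearCombination_single, hf, map_smul,
      LinearMap.smul_apply, smul_smul, mul_comm y x]

theorem linearCombination_single_one {R α M : Type*} [Semiring R] [AddCommMonoid M] [Module R M]
    (f : α → M) (a : α) : Finsupp.linearCombination R f (Finsupp.single a 1) = f a := by
  rw [Finsupp.linearCombination_single, one_smul]

/-- Linearization is left adjoint to the functor sending a linear operad to its underlying set
operad. -/
noncomputable def linearizeHomEquiv :
    Hom (P.linearize k) Q ≃ NSOperad.Hom P Q.toNSOperad where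
  toFun F :=
    { toFun n x := F.toFun n (Finsupp.single x (1 : k))
      map_one := F.map_one
      map_comp {n m l} h i a b := by
        have single_comp := P.linComp_single (k := k) h i a b 1 1
        rw [mul_one] at single_comp
        exact (congrArg (F.toFun l) single_comp.symm).trans (F.map_comp h i _ _) }
  invFun F :=
    { toFun n := Finsupp.linearCombination k (M := Q.Op n) (F.toFun n)
      map_one := (linearCombination_single_one (M := Q.Op 1) _ _).trans F.map_one
      map_comp := linearCombination_linComp (Q := Q) F.toFun F.map_comp }
  left_inv F := by
    ext1
    funext n
    exact Finsupp.lhom_ext' fun x =>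
      LinearMap.ext_ring (linearCombination_single_one (M := Q.Op n) _ _)
  right_inv F := by
    ext n x
    exact linearCombination_single_one (M := Q.Op n) _ _

theorem linearizeHomEquiv_symm_single (F : NSOperad.Hom P Q.toNSOperad) (n : ℕ) (x : P.Op n) :
    (linearizeHomEquiv.symm F).toFun n (Finsupp.single x (1 : k)) = F.toFun n x :=
  linearCombination_single_one (M := Q.Op n) _ _

theorem isFreeOn_linearize {E : ∀ n, Set (P.Op n)} (hP : NSOperad.IsFreeOn.{v, w} P E) :
    IsFreeOn.{u, max v u, w} (P.linearize k)
      (fun n => Submodule.span k ((fun x : P.Op n => Finsupp.single x (1 : k)) '' E n)) := by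
  intro Q φ
  have single_mem (n : ℕ) (x : E n) :
      (Finsupp.single (x : P.Op n) (1 : k) : (P.linearize k).Op n) ∈
        Submodule.span k ((fun x : P.Op n => Finsupp.single x (1 : k)) '' E n) :=
    Submodule.subset_span ⟨x, x.2, rfl⟩
  rw [linearizeHomEquiv.symm.bijective.existsUnique_iff]
  refine (existsUnique_congr fun F => forall_congr' fun n => ?_).1
    (hP Q.toNSOperad fun n x => φ n ⟨_, single_mem n x⟩)
  constructor
  · intro hF
    have maps_eq : ((linearizeHomEquiv.symm F).toFun n).domRestrict _ = φ n :=
      (Submodule.linearMap_eq_iff_of_eq_span _ _ rfl).2 (by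
        rintro ⟨_, x, hx, rfl⟩
        exact (linearizeHomEquiv_symm_single F n x).trans (hF ⟨x, hx⟩))
    exact fun x => LinearMap.congr_fun maps_eq x
  · exact fun hF x => (linearizeHomEquiv_symm_single F n x).symm.trans (hF ⟨_, single_mem n x⟩)

end LinNSOperad

/-! ### Subtrees and blocks -/

namespace LabelledTree

open Set Function Relation

section Subtree

variable {l m n : ℕ} {T : LabelledTree l} {s : Set (Fin l)} {r : Fin l}

theorem ext_parent_eq_some {S : LabelledTree l}
    (h : ∀ a b, T.parent a = some b ↔ S.parent a = some b) : T = S :=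
  ext_parent fun a => Option.ext fun b => h a b

theorem exists_parent_eq_some_of_ne_root {a : Fin l} (ha : a ≠ T.root) :
    ∃ b, T.parent a = some b := by
  obtain h | ⟨b, hb, -⟩ := (T.path_root a).cases_head
  · exact absurd h ha
  · exact ⟨b, hb⟩

theorem exists_mem_forall_parent_notMem (T : LabelledTree l) (hs : s.Nonempty) :
    ∃ a ∈ s, ∀ b, T.parent a = some b → b ∉ s := by
  by_contra! h
  obtain ⟨a, ha⟩ := hs
  induction T.path_root a using ReflTransGen.head_induction_on with
  | refl =>
    obtain ⟨b, hb, -⟩ := h _ ha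
    simp [T.parent_root] at hb
  | head hab _ ih =>
    obtain ⟨b, hb, hbs⟩ := h _ ha
    exact ih (Option.some_injective _ (hab.symm.trans hb) ▸ hbs)

/-- The set of vertices `s` spans a subtree of `T` with root `r`: the path from an element of `s`
to the root of `T` stays in `s` until it reaches `r`. -/
structure IsSubtree (T : LabelledTree l) (s : Set (Fin l)) (r : Fin l) : Prop where
  root_mem : r ∈ s
  exists_parent_mem : ∀ a ∈ s, a ≠ r → ∃ b ∈ s, T.parent a = some b

namespace IsSubtree

theorem parent_root_notMem (hs : T.IsSubtree s r) {b : Fin l} (hb : T.parent r = some b) :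
    b ∉ s := by
  obtain ⟨a, ha, h⟩ := T.exists_mem_forall_parent_notMem ⟨r, hs.root_mem⟩
  obtain rfl : a = r := by
    by_contra har
    obtain ⟨b, hbs, hb⟩ := hs.exists_parent_mem a ha har
    exact h b hb hbs
  exact h b hb

theorem root_eq (hs : T.IsSubtree s r) (h : T.root ∈ s) : r = T.root := by
  by_contra hr
  obtain ⟨b, -, hb⟩ := hs.exists_parent_mem _ h (Ne.symm hr)
  simp [T.parent_root] at hb

open Classical in
/-- The subtree spanned by the image of `f`, with vertices renamed along `f`. -/
noncomputable def restrict {f : Fin m → Fin l} {r : Fin m} (hf : Injective f)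
    (hs : T.IsSubtree (range f) (f r)) : LabelledTree m where
  root := r
  parent b := (T.parent (f b)).bind (partialInv f)
  parent_root := by
    refine Option.bind_eq_none_iff.2 fun b hb => dif_neg fun hbf => ?_
    exact hs.parent_root_notMem hb hbf
  path_root b := by
    generalize hx : f b = x
    induction T.path_root x using ReflTransGen.head_induction_on generalizing b with
    | refl => rw [hf (hx.trans (hs.root_eq ⟨b, hx⟩).symm)]
    | @head x y hxy _ ih =>
      obtain rfl | hbr := eq_or_ne b r
      · exact .refl
      obtain ⟨_, ⟨c, rfl⟩, hc⟩ := hs.exists_parent_mem (f b) ⟨b, rfl⟩ (hf.ne hbr)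
      refine .head ?_ (ih c (Option.some_injective _ (hc.symm.trans (hx ▸ hxy))))
      rw [hc, Option.bind_some, partialInv_left hf]

theorem restrict_parent_eq_some_iff {f : Fin m → Fin l} {r : Fin m} (hf : Injective f)
    (hs : T.IsSubtree (range f) (f r)) {b c : Fin m} :
    (hs.restrict hf).parent b = some c ↔ T.parent (f b) = some (f c) := by
  simp only [restrict, Option.bind_eq_some_iff, hf.isPartialInv _ _, exists_eq_right']

/-- The tree obtained from `T` by contracting the subtree `s` to a vertex. The map `π` sends a
vertex of `T` to its image, and `σ` is the section of `π` through the root of `s`. -/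
def contract {π : Fin l → Fin n} {σ : Fin n → Fin l} (hs : T.IsSubtree s r)
    (hπσ : LeftInverse π σ) (h_mem : ∀ a ∈ s, σ (π a) = r) (h_notMem : ∀ a ∉ s, σ (π a) = a) :
    LabelledTree n where
  root := π T.root
  parent a := (T.parent (σ a)).map π
  parent_root := by
    have section_root : σ (π T.root) = T.root := by
      by_cases h : T.root ∈ s
      · exact (h_mem _ h).trans (hs.root_eq h)
      · exact h_notMem _ h
    rw [section_root, T.parent_root, Option.map_none]
  path_root := by
    refine hπσ.surjective.forall.2 fun a => ?_
    induction T.path_root a using ReflTransGen.head_induction_on with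
    | refl => exact .refl
    | @head a b hab _ ih =>
      by_cases ha : σ (π a) = a
      · exact .head (by rw [ha, hab, Option.map_some]) ih
      have has : a ∈ s := by_contra fun has => ha (h_notMem a has)
      have har : a ≠ r := fun har => ha ((h_mem a has).trans har.symm)
      obtain ⟨c, hcs, hc⟩ := hs.exists_parent_mem a has har
      obtain rfl : b = c := Option.some_injective _ (hab.symm.trans hc)
      have image_eq : π a = π b := hπσ.injective ((h_mem a has).trans (h_mem b hcs).symm)
      rwa [image_eq]

end IsSubtree

/-- A subtree of `T` whose incoming edges end where substitution in `T_Max` grafts them: at the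
largest element of `s` if they come from below `s`, at the smallest one if they come from above.
When `s` is an interval this says that `T` is of the form `A ∘_i B` with `B` on the vertices `s`. -/
structure IsBlock (T : LabelledTree l) (s : Set (Fin l)) (r : Fin l) : Prop
    extends T.IsSubtree s r where
  isGreatest : ∀ a, (∀ x ∈ s, a < x) → ∀ b ∈ s, T.parent a = some b → IsGreatest s b
  isLeast : ∀ a, (∀ x ∈ s, x < a) → ∀ b ∈ s, T.parent a = some b → IsLeast s b

namespace IsBlock

theorem preimage {S : LabelledTree m} {f : Fin m → Fin l} {r : Fin m} (hf : StrictMono f)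
    (hs : s ⊆ range f)
    (hp : ∀ b c, f c ∈ s → (T.parent (f b) = some (f c) ↔ S.parent b = some c))
    (h : T.IsBlock s (f r)) : S.IsBlock (f ⁻¹' s) r where
  root_mem := h.root_mem
  exists_parent_mem b hb hbr := by
    obtain ⟨y, hy, hby⟩ := h.exists_parent_mem (f b) hb (hf.injective.ne hbr)
    obtain ⟨c, rfl⟩ := hs hy
    exact ⟨c, hy, (hp b c hy).1 hby⟩
  isGreatest a ha b hb hab := by
    have below : ∀ x ∈ s, f a < x := fun x hx => by
      obtain ⟨c, rfl⟩ := hs hx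
      exact hf (ha c hx)
    exact ⟨hb, fun c hc => hf.le_iff_le.1 ((h.isGreatest _ below _ hb ((hp a b hb).2 hab)).2 hc)⟩
  isLeast a ha b hb hab := by
    have above : ∀ x ∈ s, x < f a := fun x hx => by
      obtain ⟨c, rfl⟩ := hs hx
      exact hf (ha c hx)
    exact ⟨hb, fun c hc => hf.le_iff_le.1 ((h.isLeast _ above _ hb ((hp a b hb).2 hab)).2 hc)⟩

variable {I J : Set (Fin l)} {p q : Fin l}

theorem left_root_notMem (hI : T.IsSubtree I p) (hJ : T.IsBlock J q) (hIJ : (I \ J).Nonempty)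
    (hJI : (J \ I).Nonempty) (hlt : ∀ x ∈ I \ J, ∀ y ∈ J, x < y)
    (hlt' : ∀ x ∈ I, ∀ y ∈ J \ I, x < y) : p ∉ J := by
  obtain ⟨x, hx, h⟩ := T.exists_mem_forall_parent_notMem hIJ
  obtain ⟨z, hz⟩ := hJI
  obtain rfl | hxp := eq_or_ne x p
  · exact hx.2
  obtain ⟨y, hyI, hxy⟩ := hI.exists_parent_mem x hx.1 hxp
  have hyJ : y ∈ J := by_contra fun hyJ => h y hxy ⟨hyI, hyJ⟩
  have greatest := hJ.isGreatest x (hlt x hx) y hyJ hxy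
  exact absurd (greatest.2 hz.1) (hlt' y hyI z hz).not_ge

theorem right_root_notMem (hI : T.IsBlock I p) (hJ : T.IsSubtree J q) (hIJ : (I \ J).Nonempty)
    (hJI : (J \ I).Nonempty) (hlt : ∀ x ∈ I \ J, ∀ y ∈ J, x < y)
    (hlt' : ∀ x ∈ I, ∀ y ∈ J \ I, x < y) : q ∉ I := by
  obtain ⟨x, hx, h⟩ := T.exists_mem_forall_parent_notMem hJI
  obtain ⟨z, hz⟩ := hIJ
  obtain rfl | hxq := eq_or_ne x q
  · exact hx.2
  obtain ⟨y, hyJ, hxy⟩ := hJ.exists_parent_mem x hx.1 hxq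
  have hyI : y ∈ I := by_contra fun hyI => h y hxy ⟨hyJ, hyI⟩
  have least := hI.isLeast x (fun y hy => hlt' y hy x hx) y hyI hxy
  exact absurd (least.2 hz.1) (hlt z hz y hyJ).not_ge

theorem not_overlap (hI : T.IsBlock I p) (hJ : T.IsBlock J q) (hIJ : (I \ J).Nonempty)
    (hJI : (J \ I).Nonempty) (hlt : ∀ x ∈ I \ J, ∀ y ∈ J, x < y)
    (hlt' : ∀ x ∈ I, ∀ y ∈ J \ I, x < y) : ¬ (I ∩ J).Nonempty := by
  intro inter_nonempty
  have hp : p ∉ J := left_root_notMem hI.toIsSubtree hJ hIJ hJI hlt hlt'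
  have hq : q ∉ I := right_root_notMem hI hJ.toIsSubtree hIJ hJI hlt hlt'
  obtain ⟨x, ⟨hxI, hxJ⟩, h⟩ := T.exists_mem_forall_parent_notMem inter_nonempty
  obtain ⟨y, hyI, hxy⟩ := hI.exists_parent_mem x hxI (ne_of_mem_of_not_mem hxJ hp)
  obtain ⟨z, hzJ, hxz⟩ := hJ.exists_parent_mem x hxJ (ne_of_mem_of_not_mem hxI hq)
  obtain rfl : y = z := Option.some_injective _ (hxy.symm.trans hxz)
  exact h y hxy ⟨hyI, hzJ⟩

end IsBlock

end Subtree

/-! ### Blocks and substitution -/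

section Substitution

variable {n m l : ℕ} (h : l + 1 = n + m) (hm : 0 < m) (i : Fin n)

theorem embS_strictMono : StrictMono (embS h i) := fun b c hbc => by
  simpa only [embS, Fin.lt_def, Nat.add_lt_add_iff_right] using hbc

theorem mem_range_embS_iff {x : Fin l} : x ∈ range (embS h i) ↔ (i : ℕ) ≤ x ∧ (x : ℕ) < i + m := by
  simp only [mem_range, embS, Fin.ext_iff]
  refine ⟨fun ⟨b, hb⟩ => by omega, fun hx => ⟨⟨x - i, by omega⟩, by simp only; omega⟩⟩

variable {i} {a b : Fin n}

theorem embT_inj (ha : a ≠ i) (hb : b ≠ i) : embT h hm i a = embT h hm i b ↔ a = b := by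
  refine ⟨fun e => ?_, fun e => e ▸ rfl⟩
  have origin_eq := congrArg (origin h i) e
  rw [origin_embT h hm i a ha, origin_embT h hm i b hb] at origin_eq
  exact Sum.inl_injective origin_eq

theorem embT_ne_embS (ha : a ≠ i) (c : Fin m) : embT h hm i a ≠ embS h i c := fun e => by
  have origin_eq := congrArg (origin h i) e
  rw [origin_embT h hm i a ha, origin_embS h i c] at origin_eq
  exact Sum.inl_ne_inr origin_eq

theorem embT_notMem_range_embS (ha : a ≠ i) : embT h hm i a ∉ range (embS h i) :=
  fun ⟨c, hc⟩ => embT_ne_embS h hm ha c hc.symm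

theorem forall_mem_range_embS_embT_lt_iff :
    (∀ x ∈ range (embS h i), embT h hm i a < x) ↔ a < i := by
  rw [forall_mem_range]
  refine ⟨fun hlt => ?_, fun hlt b => ?_⟩
  · have := hlt ⟨0, hm⟩
    simp only [embT, embS, Fin.lt_def] at this ⊢
    split_ifs at this <;> omega
  · simp only [embT, embS, Fin.lt_def] at hlt ⊢
    rw [if_pos hlt]
    omega

theorem forall_mem_range_embS_lt_embT_iff (ha : a ≠ i) :
    (∀ x ∈ range (embS h i), x < embT h hm i a) ↔ ¬ a < i := by
  have hai : (a : ℕ) ≠ i := Fin.val_ne_of_ne ha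
  rw [forall_mem_range]
  refine ⟨fun hlt => ?_, fun hlt b => ?_⟩
  · have := hlt ⟨0, hm⟩
    simp only [embT, embS, Fin.lt_def] at this ⊢
    split_ifs at this <;> omega
  · simp only [embT, embS, Fin.lt_def] at hlt ⊢
    rw [if_neg hlt]
    omega

theorem isGreatest_range_embS_iff (ha : a < i) {b : Fin m} :
    IsGreatest (range (embS h i)) (embS h i b) ↔ b = fMax hm i a := by
  simp only [IsGreatest, mem_range_self, true_and, mem_upperBounds, forall_mem_range,
    (embS_strictMono h i).le_iff_le, fMax, if_pos ha]
  simp only [Fin.ext_iff, Fin.le_def]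
  refine ⟨fun hb => ?_, fun hb c => by omega⟩
  have last_le : m - 1 ≤ b := hb ⟨m - 1, by omega⟩
  omega

theorem isLeast_range_embS_iff (ha : ¬ a < i) {b : Fin m} :
    IsLeast (range (embS h i)) (embS h i b) ↔ b = fMax hm i a := by
  simp only [IsLeast, mem_range_self, true_and, mem_lowerBounds, forall_mem_range,
    (embS_strictMono h i).le_iff_le, fMax, if_neg ha]
  simp only [Fin.ext_iff, Fin.le_def]
  exact ⟨fun hb => Nat.le_zero.1 (hb ⟨0, hm⟩), fun hb c => by omega⟩

variable (i) in
/-- The embedding of the vertices of `T` into those of `T ∘_i S` that sends `i` to the vertex `r`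
of `S`. -/
def liftT (r : Fin m) (a : Fin n) : Fin l :=
  if a = i then embS h i r else embT h r.pos i a

variable (i) in
theorem liftT_self (r : Fin m) : liftT h i r i = embS h i r :=
  if_pos rfl

theorem liftT_of_ne (r : Fin m) (ha : a ≠ i) : liftT h i r a = embT h r.pos i a :=
  if_neg ha

variable (i) in
theorem liftT_strictMono (r : Fin m) : StrictMono (liftT h i r) := fun a b hab => by
  simp only [liftT, embT, embS, Fin.lt_def, Fin.ext_iff] at hab ⊢
  grind

variable (i) in
/-- The map from the vertices of `T ∘_i S` to those of `T` that sends all vertices of `S` to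
`i`. -/
def collapse (x : Fin l) : Fin n :=
  (origin (m := m) h i x).elim id fun _ => i

theorem collapse_embT (ha : a ≠ i) : collapse h i (embT h hm i a) = a := by
  rw [collapse, origin_embT h hm i a ha, Sum.elim_inl, id]

variable (i) in
theorem collapse_embS (c : Fin m) : collapse h i (embS h i c) = i := by
  rw [collapse, origin_embS, Sum.elim_inr]

variable (i) in
theorem collapse_leftInverse_liftT (r : Fin m) : LeftInverse (collapse h i) (liftT h i r) := by
  intro a
  obtain rfl | ha := eq_or_ne a i
  · rw [liftT_self, collapse_embS]
  · rw [liftT_of_ne h r ha, collapse_embT h r.pos ha]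

theorem liftT_collapse_of_mem (r : Fin m) {x : Fin l} (hx : x ∈ range (embS h i)) :
    liftT h i r (collapse h i x) = embS h i r := by
  obtain ⟨c, rfl⟩ := hx
  rw [collapse_embS, liftT_self]

theorem liftT_collapse_of_notMem (r : Fin m) {x : Fin l} (hx : x ∉ range (embS h i)) :
    liftT h i r (collapse h i x) = x := by
  obtain ⟨a, ha, rfl⟩ | ⟨c, rfl⟩ := eq_embT_or_eq_embS h r.pos i x
  · rw [collapse_embT h r.pos ha, liftT_of_ne h r ha]
  · exact absurd ⟨c, rfl⟩ hx

theorem collapse_eq_self_iff {x : Fin l} : collapse h i x = i ↔ x ∈ range (embS h i) := by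
  rw [mem_range_embS_iff, collapse, origin]
  split_ifs <;> simp only [Sum.elim_inl, Sum.elim_inr, id, Fin.ext_iff, true_iff] <;> omega

theorem collapse_eq_iff_of_ne (ha : a ≠ i) {x : Fin l} :
    collapse h i x = a ↔ x = embT h hm i a := by
  refine ⟨?_, fun hx => hx ▸ collapse_embT h hm ha⟩
  rintro rfl
  rw [← liftT_of_ne h ⟨0, hm⟩ ha, liftT_collapse_of_notMem]
  rwa [ne_eq, collapse_eq_self_iff] at ha

end Substitution

section Graft

variable {n m l : ℕ} {h : l + 1 = n + m} {i : Fin n} {T : LabelledTree n} {S : LabelledTree m}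
  {f : Fin n → Fin m} {a a' : Fin n} {b b' : Fin m}

theorem graft_parent_embS_eq_embS_iff :
    (graft h i T S f).parent (embS h i b) = some (embS h i b') ↔ S.parent b = some b' := by
  change graftParent h S.root.pos i T S f (embS h i b) = _ ↔ _
  rw [graftParent_embS]
  rcases S.parent b with _ | c
  · simp only [Option.map_eq_some_iff, reduceCtorEq, iff_false, not_exists, not_and]
    rintro c hc
    exact embT_ne_embS h _ (by rintro rfl; exact T.parent_ne_self _ hc) _
  · simp only [Option.some_inj, (embS_strictMono h i).injective.eq_iff]

theorem graft_parent_embS_eq_embT_iff (ha : a ≠ i) :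
    (graft h i T S f).parent (embS h i b) = some (embT h b.pos i a) ↔
      b = S.root ∧ T.parent i = some a := by
  change graftParent h S.root.pos i T S f (embS h i b) = _ ↔ _
  rw [graftParent_embS]
  rcases hb : S.parent b with _ | c
  · obtain rfl : b = S.root := by
      by_contra hbr
      obtain ⟨c, hc⟩ := exists_parent_eq_some_of_ne_root hbr
      exact Option.some_ne_none c (hc.symm.trans hb)
    rw [and_iff_right rfl]
    rcases hi : T.parent i with _ | c
    · simp only [Option.map_none, reduceCtorEq]
    · have hc : c ≠ i := fun e => T.parent_ne_self i (e ▸ hi)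
      simp only [Option.map_some, Option.some_inj, embT_inj h _ hc ha]
  · have hbr : b ≠ S.root := fun e => Option.some_ne_none c (hb.symm.trans (e ▸ S.parent_root))
    simp only [Option.some_inj, (embT_ne_embS h _ ha _).symm, hbr, false_and]

theorem graft_parent_embT_eq_embS_iff (ha : a ≠ i) :
    (graft h i T S f).parent (embT h b.pos i a) = some (embS h i b) ↔
      T.parent a = some i ∧ b = f a := by
  change graftParent h S.root.pos i T S f (embT h _ i a) = _ ↔ _
  rw [graftParent_embT h _ i T S f a ha]
  rcases T.parent a with _ | c
  · simp only [Option.map_none, reduceCtorEq, false_and]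
  · simp only [Option.map_some, Option.some_inj]
    split_ifs with hc
    · rw [(embS_strictMono h i).injective.eq_iff, and_iff_right hc, eq_comm]
    · exact iff_of_false (embT_ne_embS h _ hc b) fun e => hc e.1

theorem graft_parent_embT_eq_embT_iff (hm : 0 < m) (ha : a ≠ i) (ha' : a' ≠ i) :
    (graft h i T S f).parent (embT h hm i a) = some (embT h hm i a') ↔
      T.parent a = some a' := by
  change graftParent h S.root.pos i T S f (embT h _ i a) = _ ↔ _
  rw [graftParent_embT h _ i T S f a ha]
  rcases T.parent a with _ | c
  · simp only [Option.map_none, reduceCtorEq]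
  · simp only [Option.map_some, Option.some_inj]
    split_ifs with hc
    · subst hc
      exact iff_of_false (embT_ne_embS h _ ha' _).symm (Ne.symm ha')
    · exact embT_inj h _ hc ha'

theorem graft_parent_liftT_eq_liftT_iff (ha' : a' ≠ i) :
    (graft h i T S f).parent (liftT h i S.root a) = some (liftT h i S.root a') ↔
      T.parent a = some a' := by
  rw [liftT_of_ne h _ ha']
  obtain rfl | ha := eq_or_ne a i
  · rw [liftT_self, graft_parent_embS_eq_embT_iff ha', and_iff_right rfl]
  · rw [liftT_of_ne h _ ha, graft_parent_embT_eq_embT_iff _ ha ha']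

theorem graft_injective {T' : LabelledTree n} {S' : LabelledTree m}
    (e : graft h i T S f = graft h i T' S' f) : T = T' ∧ S = S' := by
  obtain rfl : S = S' := ext_parent_eq_some fun b b' => by
    rw [← graft_parent_embS_eq_embS_iff (h := h) (i := i) (T := T) (f := f), e,
      graft_parent_embS_eq_embS_iff]
  refine ⟨ext_parent_eq_some fun a a' => ?_, rfl⟩
  obtain rfl | ha' := eq_or_ne a' i
  · obtain rfl | ha := eq_or_ne a a'
    · exact iff_of_false (T.parent_ne_self a) (T'.parent_ne_self a)
    · have parent_eq_iff :=
        graft_parent_embT_eq_embS_iff (h := h) (T := T) (S := S) (f := f) (b := f a) ha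
      rw [e, graft_parent_embT_eq_embS_iff ha] at parent_eq_iff
      simpa only [and_true] using parent_eq_iff.symm
  · rw [← graft_parent_liftT_eq_liftT_iff (h := h) (S := S) (f := f) ha', e,
      graft_parent_liftT_eq_liftT_iff ha']

end Graft

section Factorization

variable {n m l : ℕ} (h : l + 1 = n + m) {i : Fin n}

theorem IsSubtree.exists_eq_graft {T : LabelledTree l} {r : Fin m}
    (hT : T.IsSubtree (range (embS h i)) (embS h i r)) (f : Fin n → Fin m)
    (hf : ∀ a ≠ i, ∀ b, T.parent (embT h r.pos i a) = some (embS h i b) → b = f a) :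
    ∃ (A : LabelledTree n) (B : LabelledTree m), T = graft h i A B f := by
  let A := hT.contract (collapse_leftInverse_liftT h i r)
    (fun _ => liftT_collapse_of_mem h r) (fun _ => liftT_collapse_of_notMem h r)
  let B := hT.restrict (embS_strictMono h i).injective
  have parent_A_eq_iff {a a' : Fin n} :
      A.parent a = some a' ↔ ∃ x, T.parent (liftT h i r a) = some x ∧ collapse h i x = a' :=
    Option.map_eq_some_iff
  refine ⟨A, B, ext_parent_eq_some fun x y => ?_⟩
  obtain ⟨a, ha, rfl⟩ | ⟨b, rfl⟩ := eq_embT_or_eq_embS h r.pos i x <;>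
  obtain ⟨a', ha', rfl⟩ | ⟨b', rfl⟩ := eq_embT_or_eq_embS h r.pos i y
  · rw [graft_parent_embT_eq_embT_iff _ ha ha', parent_A_eq_iff, liftT_of_ne h r ha]
    simp only [collapse_eq_iff_of_ne h r.pos ha', exists_eq_right]
  · rw [graft_parent_embT_eq_embS_iff ha, parent_A_eq_iff, liftT_of_ne h r ha]
    simp only [collapse_eq_self_iff]
    refine ⟨fun hab => ⟨⟨_, hab, mem_range_self b'⟩, hf a ha b' hab⟩, ?_⟩
    rintro ⟨⟨_, hab, c, rfl⟩, rfl⟩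
    rwa [← hf a ha c hab]
  · rw [graft_parent_embS_eq_embT_iff ha', parent_A_eq_iff, liftT_self]
    simp only [collapse_eq_iff_of_ne h r.pos ha', exists_eq_right]
    refine ⟨fun hba => ?_, by rintro ⟨rfl, hra⟩; exact hra⟩
    obtain rfl : b = r := by
      by_contra hbr
      obtain ⟨z, hz, hbz⟩ := hT.exists_parent_mem _ (mem_range_self b)
        ((embS_strictMono h i).injective.ne hbr)
      obtain rfl := Option.some_injective _ (hba.symm.trans hbz)
      exact embT_notMem_range_embS h _ ha' hz
    exact ⟨rfl, hba⟩
  · rw [graft_parent_embS_eq_embS_iff]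
    exact (hT.restrict_parent_eq_some_iff _).symm

theorem IsBlock.exists_eq_compMax {T : LabelledTree l} {r : Fin l}
    (hT : T.IsBlock (range (embS h i)) r) :
    ∃ (A : LabelledTree n) (B : LabelledTree m), T = compMax h i A B := by
  obtain ⟨r, rfl⟩ := hT.root_mem
  refine hT.toIsSubtree.exists_eq_graft h (fMax r.pos i) fun a ha b hab => ?_
  by_cases hai : a < i
  · exact (isGreatest_range_embS_iff h _ hai).1
      (hT.isGreatest _ ((forall_mem_range_embS_embT_lt_iff h _).2 hai) _ ⟨b, rfl⟩ hab)
  · exact (isLeast_range_embS_iff h _ hai).1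
      (hT.isLeast _ ((forall_mem_range_embS_lt_embT_iff h _ ha).2 hai) _ ⟨b, rfl⟩ hab)

variable (T : LabelledTree n) (S : LabelledTree m)

theorem isBlock_compMax : (compMax h i T S).IsBlock (range (embS h i)) (embS h i S.root) where
  root_mem := mem_range_self _
  exists_parent_mem := by
    rintro _ ⟨b, rfl⟩ hb
    obtain ⟨c, hc⟩ := S.exists_parent_eq_some_of_ne_root (fun e => hb (congrArg _ e))
    exact ⟨_, mem_range_self c, graft_parent_embS_eq_embS_iff.2 hc⟩
  isGreatest := by
    rintro x hx _ ⟨b, rfl⟩ hxb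
    obtain ⟨a, ha, rfl⟩ | ⟨c, rfl⟩ := eq_embT_or_eq_embS h b.pos i x
    · exact (isGreatest_range_embS_iff h _ ((forall_mem_range_embS_embT_lt_iff h _).1 hx)).2
        ((graft_parent_embT_eq_embS_iff ha).1 hxb).2
    · exact absurd (hx _ (mem_range_self c)) (lt_irrefl _)
  isLeast := by
    rintro x hx _ ⟨b, rfl⟩ hxb
    obtain ⟨a, ha, rfl⟩ | ⟨c, rfl⟩ := eq_embT_or_eq_embS h b.pos i x
    · exact (isLeast_range_embS_iff h _ ((forall_mem_range_embS_lt_embT_iff h _ ha).1 hx)).2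
        ((graft_parent_embT_eq_embS_iff ha).1 hxb).2
    · exact absurd (hx _ (mem_range_self c)) (lt_irrefl _)

end Factorization

section IteratedSubstitution

variable {n m p q r s : ℕ}

theorem embS_embS (h₂ : r + 1 = q + p) (h₃ : s + 1 = m + p) (h₄ : r + 1 = n + s) (i : Fin n)
    (j : Fin m) (hij : (i + j : ℕ) < q) (c : Fin p) :
    embS h₄ i (embS h₃ j c) = embS h₂ ⟨i + j, hij⟩ c :=
  Fin.ext (by simp only [embS]; omega)

theorem embS_lt (h₃ : q + 1 = n + p) {i : Fin q} {j : Fin n} (hji : (j + p : ℕ) ≤ i) (c : Fin p) :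
    embS h₃ j c < i := by
  simp only [embS, Fin.lt_def]
  omega

theorem liftT_embS (h₁ : r + 1 = q + m) (h₂ : r + 1 = s + p) (h₃ : q + 1 = n + p) (i : Fin q)
    (j : Fin n) (hj : (j : ℕ) < s) (hji : (j + p : ℕ) ≤ i) (b : Fin m) (c : Fin p) :
    liftT h₁ i b (embS h₃ j c) = embS h₂ ⟨j, hj⟩ c := by
  have lt := embS_lt h₃ hji c
  rw [liftT_of_ne h₁ b lt.ne]
  exact Fin.ext (if_pos lt)

theorem IsBlock.exists_inner_eq_compMax (h₂ : r + 1 = q + p) (h₃ : s + 1 = m + p)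
    (h₄ : r + 1 = n + s) (i : Fin n) (j : Fin m) (hij : (i + j : ℕ) < q) {T : LabelledTree n}
    {S : LabelledTree s} {x : Fin r}
    (hT : (compMax h₄ i T S).IsBlock (range (embS h₂ ⟨i + j, hij⟩)) x) :
    ∃ (A : LabelledTree m) (B : LabelledTree p), S = compMax h₃ j A B := by
  obtain ⟨c, rfl⟩ := hT.root_mem
  have range_eq : range (embS h₂ ⟨i + j, hij⟩) = embS h₄ i '' range (embS h₃ j) := by
    rw [← range_comp]
    exact congrArg range (funext fun c => (embS_embS h₂ h₃ h₄ i j hij c).symm)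
  rw [range_eq, ← embS_embS h₂ h₃ h₄ i j hij] at hT
  have block := hT.preimage (S := S) (embS_strictMono h₄ i) (image_subset_range _ _)
    fun _ _ _ => graft_parent_embS_eq_embS_iff
  rw [preimage_image_eq _ (embS_strictMono h₄ i).injective] at block
  exact block.exists_eq_compMax h₃

theorem IsBlock.exists_outer_eq_compMax (h₁ : r + 1 = q + m) (h₂ : r + 1 = s + p)
    (h₃ : q + 1 = n + p) (i : Fin q) (j : Fin n) (hj : (j : ℕ) < s) (hji : (j + p : ℕ) ≤ i)
    {T : LabelledTree q} {S : LabelledTree m} {x : Fin r}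
    (hT : (compMax h₁ i T S).IsBlock (range (embS h₂ ⟨j, hj⟩)) x) :
    ∃ (A : LabelledTree n) (B : LabelledTree p), T = compMax h₃ j A B := by
  obtain ⟨c, rfl⟩ := hT.root_mem
  have liftT_embS (c : Fin p) := liftT_embS h₁ h₂ h₃ i j hj hji S.root c
  have range_eq : range (embS h₂ ⟨j, hj⟩) = liftT h₁ i S.root '' range (embS h₃ j) := by
    rw [← range_comp]
    exact congrArg range (funext fun c => (liftT_embS c).symm)
  rw [range_eq, ← liftT_embS] at hT
  have block := hT.preimage (S := T) (liftT_strictMono h₁ i S.root) (image_subset_range _ _) ?_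
  · rw [preimage_image_eq _ (liftT_strictMono h₁ i S.root).injective] at block
    exact block.exists_eq_compMax h₃
  rintro a a' ⟨_, ⟨c, rfl⟩, hc⟩
  obtain rfl : embS h₃ j c = a' := (liftT_strictMono h₁ i S.root).injective hc
  exact graft_parent_liftT_eq_liftT_iff (embS_lt h₃ hji c).ne

end IteratedSubstitution

end LabelledTree

namespace TMax

open LabelledTree Set

theorem isReduced : TMax.IsReduced := by
  refine ⟨⟨fun T : LabelledTree 0 => T.root.elim0⟩, fun T : LabelledTree 1 => ?_⟩
  refine ext_parent (S := LabelledTree.single) fun a => ?_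
  rw [Subsingleton.elim a T.root, T.parent_root, Subsingleton.elim T.root single.root,
    single.parent_root]

variable {l : ℕ} {T : LabelledTree l}

theorem isBlock_range_embS (d : TMax.Decomposition T) :
    T.IsBlock (range (embS d.h d.i)) (embS d.h d.i d.b.root) := by
  have := isBlock_compMax d.h (i := d.i) d.a d.b
  rwa [← show T = compMax d.h d.i d.a d.b from d.eq_comp] at this

theorem nested (d d' : TMax.Decomposition T) (h₁ : (d.i : ℕ) ≤ d'.i)
    (h₂ : (d'.i : ℕ) + d'.m ≤ d.i + d.m) : d.Nested d' := by
  have block := isBlock_range_embS d'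
  obtain ⟨n, m, h, i, A, B, hn, hm, rfl⟩ := d
  obtain ⟨n', m', h', i', A', B', hn', hm', e⟩ := d'
  simp only at h₁ h₂ block
  obtain ⟨s, h₃⟩ : ∃ s, m + 1 = s + m' := ⟨m + 1 - m', by omega⟩
  have h₄ : n' + 1 = n + s := by omega
  obtain ⟨j, hj⟩ := Nat.exists_eq_add_of_le h₁
  have hjs : j < s := by omega
  have hij : i + j < n' := by omega
  obtain rfl : i' = ⟨i + j, hij⟩ := Fin.ext hj
  obtain ⟨C, D, rfl⟩ := block.exists_inner_eq_compMax h' h₃ h i ⟨j, hjs⟩ hij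
  obtain ⟨rfl, rfl⟩ := graft_injective ((compMax_assoc h₄ h' h₃ h i ⟨j, hjs⟩ A C D).trans e)
  exact ⟨s, h₃, h₄, ⟨j, hjs⟩, C, rfl, rfl, rfl⟩

theorem parallel (d d' : TMax.Decomposition T) (hd : (d'.i : ℕ) + d'.m ≤ d.i) :
    d.Parallel d' := by
  have block := isBlock_range_embS d'
  obtain ⟨n, m, h, i, A, B, hn, hm, rfl⟩ := d
  obtain ⟨n', m', h', i', A', B', hn', hm', e⟩ := d'
  simp only at hd block
  obtain ⟨s, h₃⟩ : ∃ s, n + 1 = s + m' := ⟨n + 1 - m', by omega⟩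
  have h₄ : n' + 1 = s + m := by omega
  have lt_s : (i' : ℕ) < s := by omega
  obtain ⟨j, hj⟩ : ∃ j, (i : ℕ) = j + m' - 1 := ⟨i + 1 - m', by omega⟩
  have hjs : j < s := by omega
  have lt_j : i' < j := by omega
  obtain ⟨C, D, rfl⟩ := block.exists_outer_eq_compMax h h' h₃ i ⟨i', lt_s⟩ i'.isLt hd
  have hjn : j + m' - 1 < n := by omega
  obtain rfl : i = ⟨j + m' - 1, hjn⟩ := Fin.ext hj
  obtain ⟨rfl, rfl⟩ := graft_injective
    ((compMax_comm h₄ h' h₃ h ⟨j, hjs⟩ ⟨i', lt_s⟩ lt_j C B D).trans e)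
  exact ⟨s, h₃, h₄, ⟨j, hjs⟩, ⟨i', lt_s⟩, C, lt_j, rfl, rfl, rfl, rfl⟩

theorem not_overlap (d d' : TMax.Decomposition T) :
    ¬ ((d.i : ℕ) < d'.i ∧ (d'.i : ℕ) < d.i + d.m ∧ (d.i : ℕ) + d.m < d'.i + d'.m) := by
  intro overlap
  have := d.h
  have := d.two_le_m
  have := d.i.isLt
  have := d'.h
  have := d'.i.isLt
  refine (isBlock_range_embS d).not_overlap (isBlock_range_embS d')
    ⟨⟨d.i, by omega⟩, ?_⟩ ⟨⟨d.i + d.m, by omega⟩, ?_⟩ ?_ ?_ ⟨⟨d'.i, by omega⟩, ?_⟩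
  all_goals
    simp only [mem_sdiff, mem_inter_iff, mem_range_embS_iff, Fin.lt_def]
    grind

theorem hasCompatibleDecompositions : TMax.HasCompatibleDecompositions := by
  intro l x d d'
  by_cases h₁ : (d'.i : ℕ) + d'.m ≤ d.i
  · exact .inr (.inr (.inl (parallel d d' h₁)))
  by_cases h₂ : (d.i : ℕ) + d.m ≤ d'.i
  · exact .inr (.inr (.inr (parallel d' d h₂)))
  by_cases h₃ : (d.i : ℕ) ≤ d'.i ∧ (d'.i : ℕ) + d'.m ≤ d.i + d.m
  · exact .inl (nested d d' h₃.1 h₃.2)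
  by_cases h₄ : (d'.i : ℕ) ≤ d.i ∧ (d.i : ℕ) + d.m ≤ d'.i + d'.m
  · exact .inr (.inl (nested d' d h₄.1 h₄.2))
  have := not_overlap d d'
  have := not_overlap d' d
  omega

theorem isFreeOn_indecomposables : NSOperad.IsFreeOn.{0, v} TMax TMax.indecomposables :=
  NSOperad.isFreeOn_indecomposables isReduced hasCompatibleDecompositions

end TMax

theorem mainTheorem2 :
    (TMax.IsReduced ∧ NSOperad.IsFreeOn.{0, v} TMax TMax.indecomposables) ∧
    ∀ (k : Type u) [Field k],
      (TMax.linearize k).IsReduced ∧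
      LinNSOperad.IsFreeOn.{u, u, w} (TMax.linearize k)
        (fun n => Submodule.span k
          ((fun T : TMax.Op n => Finsupp.single T (1 : k)) '' TMax.indecomposables n)) :=
  ⟨⟨TMax.isReduced, TMax.isFreeOn_indecomposables⟩, fun k _ =>
    ⟨TMax.isReduced.linearize k, LinNSOperad.isFreeOn_linearize TMax.isFreeOn_indecomposables⟩⟩
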